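/- Let $n\ge 0$. A matching of length $n$ is a partition of $\{1,\dots,2n\}$ into arcs $[a_i,b_i]$, $a_i<b_i$, $a_1<\dots<a_n$. It is a *Stoimenow matching* if it has no two nested arcs with adjacent openers ($[i,\ell],[i+1,k]$ with $k<\ell$) and no two nested arcs with adjacent closers ($[k,j+1],[\ell,j]$ with $k<\ell$). Let $\mathcal M_n(P_2)$ be the set of Stoimenow matchings of length $n$ in which no four arcs form a submatching order-isomorphic to $P_2=\{[1,3],[2,5],[4,7],[6,8]\}$. An *ascent* of an integer sequence $\alpha=(\alpha_1,\dots,\alpha_n)$ is an index $1\le i<n$ with $\alpha_i<\alpha_{i+1}$; $\alpha$ is an *ascent sequence* if $\alpha_1=0$ and $0\le\alpha_i\le 1+\mathrm{asc}(\alpha_1,\dots,\alpha_{i-1})$ for $2\le i\le n$, where $\mathrm{asc}$ is the number of ascents. A permutation $\pi$ of $\{1,\dots,n\}$ is a *Fishburn permutation* if there are no $i,j$ with $j>i+1$ and $\pi_j+1=\pi_i<\pi_{i+1}$. A word contains a pattern if it has a subsequence order-isomorphic to it, and avoids it otherwise. Let $\mathcal F_n(3142)$ be the set of $3142$-avoiding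 Fishburn permutations of length $n$. Define the following maps. * $\Omega$ sends a matching to the poset on $\{p_1,\dots,p_n\}$ with $p_i<p_j$ iff $b_i<a_j$. Such a poset is $(\mathbf{2+2})$-free, so its different strict down-sets form a chain $D_0\subsetneq D_1\subsetneq\cdots$, and $x$ is said to have level $i$ if its strict down-set $D(x)$ is $D_i$. * $\mathcal O$ sends a $(\mathbf{2+2})$-free poset $P$ with $n$ elements to a sequence of length $n$, recursively: the last entry is the least level $i$ containing a maximal element of $P$. Let $y$ be a maximal element of level $i$ (any two such elements are interchangeable). If $y$ is the only element of its level and $i$ is not the highest level, first delete all relations $u<v$ with $u\in D_{i+1}\setminus D_i$. Then remove $y$; the first $n-1$ entries are $\mathcal O$ of the poset that is left. Put $\Psi=\mathcal O\circ\Omega$. * For $1\le j\le n-1$ let $M(\alpha,j)$ arise from $\alpha$ by adding $1$ to every $\alpha_i$ with $i<j$ and $\alpha_i\ge\alpha_{j+1}$. If $j_1<\dots<j_k$ are the ascents of $\alpha$, then $\Delta(\alpha)$ is obtained from $\alpha$ by applying $M(\cdot,j_1)$, then $M(\cdot,j_2)$, ..., then $M(\cdot,j_k)$. * $\mathcal T(\alpha)$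 is the permutation obtained by sorting the columns $\binom{\alpha_i}{i}$, $1\le i\le n$, in weakly increasing order of the top entries and, among equal top entries, in decreasing order of the bottom entries, and reading the bottom row. **Theorem.** For every $n\ge 0$, the map $\Upsilon=\mathcal T\circ\Delta\circ\Psi$ restricts to a bijection from $\mathcal M_n(P_2)$ onto $\mathcal F_n(3142)$. Moreover, an ascent sequence of length $n$ avoids $0101$ if and only if it avoids $101$, and $\Delta(\alpha)=\alpha$ for every such ascent sequence $\alpha$. -/

import Mathlib

namespace Fishburn

/-! ### Matchings -/

/-- A matching on the `2 * n` points `0 < 1 < ⋯ < 2 * n - 1`, i.e. a partition of them into `n` arcs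
`[opener i, closer i]`. The arcs are indexed by increasing opener, so that every partition into
arcs is represented exactly once. -/
structure Matching (n : ℕ) where
  opener : Fin n → Fin (2 * n)
  closer : Fin n → Fin (2 * n)
  opener_strictMono : StrictMono opener
  opener_lt_closer : ∀ i, opener i < closer i
  endpoints_bijective : Function.Bijective (Sum.elim opener closer)

namespace Matching

/-- No Type I arcs (two nested arcs with adjacent openers) and no Type II arcs (two nested arcs
with adjacent closers). -/
def IsStoimenow {n : ℕ} (M : Matching n) : Prop :=
  (∀ i j, (M.opener j : ℕ) = M.opener i + 1 → ¬ M.closer j < M.closer i) ∧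
  (∀ i j, (M.closer i : ℕ) = M.closer j + 1 → ¬ M.opener i < M.opener j)

/-- `M` contains the pattern `P`: some set of arcs of `M`, chosen by `f`, forms a submatching
isomorphic to `P`, i.e. its endpoints are in the same relative order as those of `P`. -/
def Contains {n k : ℕ} (M : Matching n) (P : Matching k) : Prop :=
  ∃ f : Fin k ↪o Fin n, ∀ i j : Fin k,
    (P.closer i < P.closer j ↔ M.closer (f i) < M.closer (f j)) ∧
    (P.opener i < P.closer j ↔ M.opener (f i) < M.closer (f j))

/-- The pattern `P₂`, the 4-chain with arcs `[0, 2], [1, 4], [3, 6], [5, 7]`. -/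
def patternP2 : Matching 4 where
  opener := ![0, 1, 3, 5]
  closer := ![2, 4, 6, 7]
  opener_strictMono := by decide
  opener_lt_closer := by decide
  endpoints_bijective := by decide

end Matching

/-! ### Finite posets and the map from posets to integer sequences -/

/-- A finite poset, given by its set of elements `carrier` and its strict order `lt`. -/
structure FinPoset (V : Type) where
  carrier : Finset V
  lt : V → V → Prop
  decLt : DecidableRel lt
  mem_of_lt : ∀ {x y}, lt x y → x ∈ carrier ∧ y ∈ carrier
  irrefl : ∀ x, ¬ lt x x
  trans : ∀ {x y z}, lt x y → lt y z → lt x z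

attribute [instance] FinPoset.decLt

namespace FinPoset

variable {V : Type} [LinearOrder V]

/-- The strict down-set `D(x)`, the set of predecessors of `x`. -/
def down (P : FinPoset V) (x : V) : Finset V := P.carrier.filter fun z => P.lt z x

/-- The level of `x`: the number of different sets `D(z)`, `z ∈ P`, that are properly contained
in `D(x)`. If `P` is (2+2)-free, its sets of predecessors form a chain `D_0 ⊂ D_1 ⊂ ⋯`,
and `x` has level `i` if and only if `D(x) = D_i`. -/
def level (P : FinPoset V) (x : V) : ℕ :=
  ((P.carrier.image P.down).filter fun d => d ⊂ P.down x).card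

/-- The `i`-th level `L_i` of `P`. -/
def levelSet (P : FinPoset V) (i : ℕ) : Finset V := P.carrier.filter fun x => P.level x = i

/-- The maximal elements of `P`. -/
def maximals (P : FinPoset V) : Finset V :=
  P.carrier.filter fun x => ∀ z ∈ P.carrier, ¬ P.lt x z

/-- `ℓ⋆(P)`, the least level that contains a maximal element (`0` for the empty poset). -/
def minMaxLevel (P : FinPoset V) : ℕ := (P.maximals.image P.level).min.untopD 0

/-- For `y` on level `i`: the set `D_{i+1} \ D_i` if `y` is the only element of its level, and the
empty set otherwise. It is also empty if level `i` is the highest one. -/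
def freed (P : FinPoset V) (y : V) : Finset V :=
  if P.levelSet (P.level y) = {y} then
    (P.levelSet (P.level y + 1)).biUnion fun z => P.down z \ P.down y
  else ∅

/-- Remove `y`, after deleting all the relations `u < v` with `u ∈ freed y`. -/
def removeAt (P : FinPoset V) (y : V) : FinPoset V where
  carrier := P.carrier.erase y
  lt u v := P.lt u v ∧ u ∉ P.freed y ∧ u ≠ y ∧ v ≠ y
  decLt := fun _ _ => inferInstance
  mem_of_lt h :=
    ⟨Finset.mem_erase.2 ⟨h.2.2.1, (P.mem_of_lt h.1).1⟩,
      Finset.mem_erase.2 ⟨h.2.2.2, (P.mem_of_lt h.1).2⟩⟩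
  irrefl x h := P.irrefl x h.1
  trans h₁ h₂ := ⟨P.trans h₁.1 h₂.1, h₁.2.1, h₁.2.2.1, h₂.2.2.2⟩

/-- One step of the decomposition of a (2+2)-free poset: remove a maximal element of level
`ℓ⋆(P)`. In a (2+2)-free poset these elements have the same predecessors and the same (empty) set
of successors, so that they are interchangeable; we take the one with the smallest label. -/
def remove (P : FinPoset V) : FinPoset V :=
  match (P.maximals.filter fun x => P.level x = P.minMaxLevel).min with
  | ⊤ => P
  | (y : V) => P.removeAt y

/-- The map `𝒪` from (2+2)-free posets with `n` elements to ascent sequences of length `n`: the last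
entry is `ℓ⋆(P)`, the one before it is `ℓ⋆` of the poset that is left after one removal,
and so on. -/
def toSeq (P : FinPoset V) (n : ℕ) (_hn : P.carrier.card = n) : Fin n → ℕ :=
  fun k => (remove^[n - 1 - k] P).minMaxLevel

end FinPoset

namespace Matching

/-- The poset `Ω(M)` on the arcs of `M`: `p_i < p_j` if the `i`-th arc closes before the `j`-th
arc opens. -/
def toPoset {n : ℕ} (M : Matching n) : FinPoset (Fin n) where
  carrier := Finset.univ
  lt i j := M.closer i < M.opener j
  decLt := fun _ _ => inferInstance
  mem_of_lt _ := ⟨Finset.mem_univ _, Finset.mem_univ _⟩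
  irrefl i h := lt_asymm h (M.opener_lt_closer i)
  trans {_ j _} h₁ h₂ := (h₁.trans (M.opener_lt_closer j)).trans h₂

/-- `Ψ = 𝒪 ∘ Ω`, from matchings to integer sequences. -/
def Psi {n : ℕ} (M : Matching n) : Fin n → ℕ :=
  M.toPoset.toSeq n (Finset.card_fin n)

end Matching

/-! ### Sequences -/

/-- The word `w` contains the pattern `p`: some subsequence of `w` is order-isomorphic to `p`. -/
def ContainsPattern {α : Type} [LinearOrder α] {n k : ℕ} (w : Fin n → α) (p : Fin k → ℕ) : Prop :=
  ∃ f : Fin k ↪o Fin n, ∀ i j : Fin k, p i < p j ↔ w (f i) < w (f j)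

/-- `j` is an ascent of `α` (positions are counted from `0`). -/
def IsAscent {n : ℕ} (α : Fin n → ℕ) (j : ℕ) : Prop :=
  ∃ h : j + 1 < n, α ⟨j, Nat.lt_of_succ_lt h⟩ < α ⟨j + 1, h⟩

instance {n : ℕ} (α : Fin n → ℕ) : DecidablePred (IsAscent α) :=
  fun j => inferInstanceAs
    (Decidable (∃ h : j + 1 < n, α ⟨j, Nat.lt_of_succ_lt h⟩ < α ⟨j + 1, h⟩))

/-- The number of ascents of the prefix of `α` formed by its first `m` entries. -/
def ascPrefix {n : ℕ} (α : Fin n → ℕ) (m : ℕ) : ℕ :=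
  ((Finset.range n).filter fun j => j + 1 < m ∧ IsAscent α j).card

/-- Ascent sequences: the first entry is `0`, and every other entry is at most one more than the
number of ascents of the prefix before it. -/
def IsAscentSeq {n : ℕ} (α : Fin n → ℕ) : Prop :=
  ∀ i : Fin n, ((i : ℕ) = 0 → α i = 0) ∧ ((i : ℕ) ≠ 0 → α i ≤ 1 + ascPrefix α i)

/-- `M(α, j)`: add `1` to the entries to the left of position `j` that are at least
`α (j + 1)`. -/
def modifyAt {n : ℕ} (α : Fin n → ℕ) (j : ℕ) : Fin n → ℕ :=
  if h : j + 1 < n then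
    fun i => if (i : ℕ) < j ∧ α ⟨j + 1, h⟩ ≤ α i then α i + 1 else α i
  else α

/-- `Asc(α)`: the ascents of `α` in increasing order. -/
def ascList {n : ℕ} (α : Fin n → ℕ) : List ℕ :=
  (List.range n).filter fun j => IsAscent α j

/-- The modification map `Δ(α) = M(α, Asc(α))`. -/
def Delta {n : ℕ} (α : Fin n → ℕ) : Fin n → ℕ :=
  (ascList α).foldl modifyAt α

/-! ### Permutations

A permutation `π` of `Fin n` is read as the word `π 0, π 1, …, π (n - 1)`. -/

/-- The transposition `𝒯`: flip the biword with rows `id` and `α`, so that its columns become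
`(α i, i)`, and sort the columns by their top entries in weakly increasing order and, where the
top entries are equal, by their bottom entries in decreasing order; the bottom row is `𝒯(α)`. -/
def transposition {n : ℕ} (α : Fin n → ℕ) : Equiv.Perm (Fin n) :=
  Tuple.sort fun i => toLex (α i, OrderDual.toDual i)

/-- Avoidance of the Fishburn pattern: there are no positions `i`, `j` with `j > i + 1` and
`π_j + 1 = π_i < π_{i+1}`. -/
def IsFishburn {n : ℕ} (π : Equiv.Perm (Fin n)) : Prop :=
  ¬ ∃ i i' j : Fin n, (i' : ℕ) = i + 1 ∧ i' < j ∧ (π j : ℕ) + 1 = π i ∧ π i < π i'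

/-- `Υ = 𝒯 ∘ Δ ∘ Ψ`, from matchings to permutations. -/
def Upsilon {n : ℕ} (M : Matching n) : Equiv.Perm (Fin n) :=
  transposition (Delta M.Psi)

end Fishburn

namespace Fishburn

/-! ### Restricted growth functions -/

/-! The two sides meet in the restricted growth functions that avoid 101; every ascent sequence
avoiding 0101 is one of them (`IsAscentSeq.isRGF`). In such a sequence each ascent top is a new
strict maximum, so `Delta` fixes it, and the theorem follows by composing `Matching.Psi_bijOn` with
`transposition_bijOn`.

Permutations: the descending runs of 𝒯(α) are the level sets of α. Restricted growth makes every
ascent bottom a right-to-left minimum and turns 101 into 3142. Conversely, a 3142-avoiding Fishburn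
permutation has such ascent bottoms, and numbering its runs recovers α.

Matchings: `height` numbers the blocks of endpoints, so that an arc becomes an interval [ℓ, r] and
Ω(M) an interval order. The Stoimenow conditions make the intervals determine the matching, and
avoiding P₂ means that no two intervals cross. Every number up to the largest endpoint is both a
left and a right endpoint, so noncrossing forces every point [j, j] to occur. Then no removal in 𝒪
deletes a further relation, and Ψ(M) lists the left endpoints by increasing right and then
decreasing left endpoint. The right endpoints are its prefix maxima, which gives the inverse. -/

/-- Every value below `α i` occurs before position `i`. -/
def IsRGF {n : ℕ} (α : Fin n → ℕ) : Prop :=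
  ∀ i, ∀ v < α i, ∃ j < i, α j = v

/-- The explicit form of avoiding the pattern `101`. -/
def Avoids101 {n : ℕ} (α : Fin n → ℕ) : Prop :=
  ∀ p q s, p < q → q < s → α p = α s → ¬ α q < α p

theorem not_containsPattern_101_iff {n : ℕ} (α : Fin n → ℕ) :
    ¬ ContainsPattern α ![1, 0, 1] ↔ Avoids101 α := by
  constructor
  · intro h p q s hpq hqs hps hlt
    refine h ⟨OrderEmbedding.ofStrictMono ![p, q, s] ?_, ?_⟩
    · rw [Fin.strictMono_iff_lt_succ]
      intro i
      fin_cases i <;> simp [hpq, hqs]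
    · intro i j
      fin_cases i <;> fin_cases j <;> simp <;> omega
  · rintro h ⟨f, hf⟩
    have h1 := hf 0 2
    have h2 := hf 2 0
    have h3 := hf 1 0
    simp at h1 h2 h3
    exact h (f 0) (f 1) (f 2) (f.strictMono (by decide)) (f.strictMono (by decide)) (by omega) h3

theorem containsPattern_0101_iff {n : ℕ} (α : Fin n → ℕ) :
    ContainsPattern α ![0, 1, 0, 1] ↔
      ∃ o p q s, o < p ∧ p < q ∧ q < s ∧ α o = α q ∧ α p = α s ∧ α q < α p := by
  constructor
  · rintro ⟨f, hf⟩
    have h1 := hf 0 2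
    have h2 := hf 2 0
    have h3 := hf 1 3
    have h4 := hf 3 1
    have h5 := hf 2 1
    simp at h1 h2 h3 h4 h5
    exact ⟨f 0, f 1, f 2, f 3, f.strictMono (by decide), f.strictMono (by decide),
      f.strictMono (by decide), by omega, by omega, h5⟩
  · rintro ⟨o, p, q, s, hop, hpq, hqs, h1, h2, h3⟩
    refine ⟨OrderEmbedding.ofStrictMono ![o, p, q, s] ?_, ?_⟩
    · rw [Fin.strictMono_iff_lt_succ]
      intro i
      fin_cases i <;> simp [hop, hpq, hqs]
    · intro i j
      fin_cases i <;> fin_cases j <;> simp <;> omega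

theorem IsRGF.avoids101 {n : ℕ} {α : Fin n → ℕ} (hα : IsRGF α)
    (h : ¬ ContainsPattern α ![0, 1, 0, 1]) : Avoids101 α := by
  intro p q s hpq hqs hps hlt
  obtain ⟨o, ho, hoq⟩ := hα p _ hlt
  exact h ((containsPattern_0101_iff α).2 ⟨o, p, q, s, ho, hpq, hqs, hoq, hps, hlt⟩)

theorem Avoids101.not_containsPattern_0101 {n : ℕ} {α : Fin n → ℕ} (h : Avoids101 α) :
    ¬ ContainsPattern α ![0, 1, 0, 1] := by
  rw [containsPattern_0101_iff]
  rintro ⟨o, p, q, s, -, hpq, hqs, -, hps, hlt⟩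
  exact h p q s hpq hqs hps hlt

/-- An ascent sequence that avoids `0101` is a restricted growth function: its ascent tops are
different. -/
theorem IsAscentSeq.isRGF {n : ℕ} {α : Fin n → ℕ} (hα : IsAscentSeq α)
    (h : ¬ ContainsPattern α ![0, 1, 0, 1]) : IsRGF α := by
  intro i
  induction i using WellFoundedLT.induction with
  | _ i ih =>
  intro v hv
  rcases Nat.eq_zero_or_pos (i : ℕ) with hi0 | hi0
  · have := (hα i).1 hi0
    omega
  have hle := (hα i).2 hi0.ne'
  obtain ⟨m, hm, hmax⟩ := (Finset.Iio i).exists_max_image α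
    ⟨⟨0, hi0.trans i.2⟩, by simpa [Fin.lt_def] using hi0⟩
  rw [Finset.mem_Iio] at hm
  -- Ascent tops are distinct and lie in `[1, α m]`, whence `α i ≤ 1 + α m`.
  have hcard : ascPrefix α i ≤ (Finset.Icc 1 (α m)).card := by
    refine Finset.card_le_card_of_injOn
      (fun j => if hj : j + 1 < n then α ⟨j + 1, hj⟩ else 0) ?_ ?_
    · intro j hj
      simp only [Finset.coe_filter, Finset.mem_range, Set.mem_ofPred_eq] at hj
      obtain ⟨-, hji, hjn, hasc⟩ := hj
      simp only [dif_pos hjn, Finset.coe_Icc, Set.mem_Icc]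
      exact ⟨by omega, hmax _ (by simpa [Fin.lt_def] using hji)⟩
    -- If two ascents share their top, the lower bottom `α k` occurs before `j + 1` by `ih`, which
    -- completes a 0101.
    · have aux : ∀ j k : ℕ, j < k → ∀ (hj : j + 1 < n) (hk : k + 1 < n), k + 1 < i →
          α ⟨j + 1, hj⟩ = α ⟨k + 1, hk⟩ → ¬ α ⟨k, by omega⟩ < α ⟨k + 1, hk⟩ := by
        intro j k hjk hj hk hki heq hasc
        obtain ⟨o, ho, hov⟩ := ih ⟨j + 1, hj⟩ (by rw [Fin.lt_def]; simp only; omega)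
          (α ⟨k, by omega⟩) (by omega)
        have hne : j + 1 ≠ k := by rintro rfl; omega
        refine h ((containsPattern_0101_iff α).2 ⟨o, ⟨j + 1, hj⟩, ⟨k, by omega⟩, ⟨k + 1, hk⟩, ho,
          ?_, ?_, hov, heq, by omega⟩) <;> rw [Fin.lt_def] <;> simp only <;> omega
      intro j hj k hk heq
      simp only [Finset.coe_filter, Finset.mem_range, Set.mem_ofPred_eq] at hj hk
      obtain ⟨-, hji, hjn, hja⟩ := hj
      obtain ⟨-, hki, hkn, hka⟩ := hk
      simp only [dif_pos hjn, dif_pos hkn] at heq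
      rcases lt_trichotomy j k with hlt | rfl | hlt
      · exact absurd hka (aux j k hlt hjn hkn hki heq)
      · rfl
      · exact absurd hja (aux k j hlt hkn hjn hji heq.symm)
  rw [Nat.card_Icc] at hcard
  rcases (show v ≤ α m by omega).eq_or_lt with rfl | hvm
  · exact ⟨m, hm, rfl⟩
  · obtain ⟨j, hj, hjv⟩ := ih m hm v hvm
    exact ⟨j, hj.trans hm, hjv⟩

/-- In a restricted growth function that avoids `101`, every ascent top is a new maximum. -/
theorem IsRGF.lt_of_isAscent {n : ℕ} {α : Fin n → ℕ} (hα : IsRGF α) (h : Avoids101 α) {j : ℕ}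
    (hj : j + 1 < n) (hasc : α ⟨j, Nat.lt_of_succ_lt hj⟩ < α ⟨j + 1, hj⟩) (i : Fin n)
    (hi : (i : ℕ) ≤ j) : α i < α ⟨j + 1, hj⟩ := by
  by_contra! hle
  -- Otherwise the value of the ascent top has already occurred, and the ascent bottom completes a
  -- 101.
  obtain ⟨p, hp, hpv⟩ : ∃ p ≤ i, α p = α ⟨j + 1, hj⟩ := by
    rcases hle.eq_or_lt with h1 | h1
    · exact ⟨i, le_rfl, h1.symm⟩
    · obtain ⟨p, hp, hpv⟩ := hα i _ h1
      exact ⟨p, hp.le, hpv⟩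
  have hpj : p ≠ ⟨j, Nat.lt_of_succ_lt hj⟩ := by rintro rfl; omega
  refine h p ⟨j, Nat.lt_of_succ_lt hj⟩ ⟨j + 1, hj⟩ ?_ (by simp [Fin.lt_def]) hpv (by omega)
  refine lt_of_le_of_ne ?_ hpj
  rw [Fin.le_def] at hp ⊢
  exact hp.trans hi

theorem Delta_eq_self {n : ℕ} {α : Fin n → ℕ} (hα : IsRGF α) (h : Avoids101 α) :
    Delta α = α := by
  have key : ∀ j, IsAscent α j → modifyAt α j = α := by
    rintro j ⟨hj, hasc⟩
    funext i
    rw [modifyAt, dif_pos hj, if_neg]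
    rintro ⟨hi, hle⟩
    exact absurd (hα.lt_of_isAscent h hj hasc i hi.le) (by omega)
  have fold : ∀ l : List ℕ, (∀ j ∈ l, IsAscent α j) → l.foldl modifyAt α = α := by
    intro l
    induction l with
    | nil => simp
    | cons j l ih =>
      intro hl
      rw [List.foldl_cons, key j (hl j (by simp)), ih fun k hk => hl k (by simp [hk])]
  exact fold _ fun j hj => by simpa [ascList] using (List.mem_filter.1 hj).2

/-! ### The transposition -/

/-- Here `(transposition α).symm x` is the position of the letter `x` in the word 𝒯(α). -/
theorem transposition_symm_lt_iff {n : ℕ} (α : Fin n → ℕ) (x y : Fin n) :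
    (transposition α).symm x < (transposition α).symm y ↔
      α x < α y ∨ α x = α y ∧ y < x := by
  have hinj : Function.Injective fun i => toLex (α i, OrderDual.toDual i) := by
    intro i j hij
    simpa using congrArg (fun p => OrderDual.ofDual (ofLex p).2) hij
  have hmono : StrictMono ((fun i => toLex (α i, OrderDual.toDual i)) ∘ transposition α) :=
    (Tuple.monotone_sort _).strictMono_of_injective (hinj.comp (transposition α).injective)
  rw [← hmono.lt_iff_lt]
  simp [Prod.Lex.toLex_lt_toLex]

theorem eq_transposition {n : ℕ} {α : Fin n → ℕ} {π : Equiv.Perm (Fin n)}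
    (h : ∀ i j, i < j → α (π i) < α (π j) ∨ α (π i) = α (π j) ∧ π j < π i) :
    π = transposition α := by
  refine Tuple.eq_sort_iff.2 ⟨?_, ?_⟩
  · intro i j hij
    rcases hij.eq_or_lt with rfl | hij
    · exact le_rfl
    · rw [Function.comp_apply, Function.comp_apply, Prod.Lex.toLex_le_toLex]
      exact (h i j hij).imp id fun h => ⟨h.1, OrderDual.toDual_le_toDual.2 h.2.le⟩
  · intro i j hij heq
    have : π i = π j := by simpa using congrArg (fun p => OrderDual.ofDual (ofLex p).2) heq
    exact absurd (π.injective this) hij.ne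

theorem transposition_spec {n : ℕ} (α : Fin n → ℕ) {i j : Fin n} (hij : i < j) :
    α (transposition α i) < α (transposition α j) ∨
      α (transposition α i) = α (transposition α j) ∧ transposition α j < transposition α i := by
  simpa [hij] using (transposition_symm_lt_iff α (transposition α i) (transposition α j)).1

theorem transposition_monotone {n : ℕ} (α : Fin n → ℕ) : Monotone (α ∘ transposition α) := by
  intro i j hij
  rcases hij.eq_or_lt with rfl | hij
  · exact le_rfl
  · rcases transposition_spec α hij with h | h
    · exact h.le
    · exact h.1.le

/-! ### Ascent bottoms, the Fishburn pattern and 3142. -/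

/-- The values at the bottoms of the descending runs are right-to-left minima. -/
def HasMinimalAscentBottoms {n : ℕ} (π : Equiv.Perm (Fin n)) : Prop :=
  ∀ i i' : Fin n, (i' : ℕ) = i + 1 → π i < π i' → ∀ h, i < h → π i < π h

theorem HasMinimalAscentBottoms.isFishburn {n : ℕ} {π : Equiv.Perm (Fin n)}
    (h : HasMinimalAscentBottoms π) : IsFishburn π := by
  rintro ⟨i, i', j, hii', hij, hval, hasc⟩
  have := h i i' hii' hasc j (by rw [Fin.lt_def] at hij ⊢; omega)
  rw [Fin.lt_def] at this
  omega

theorem containsPattern_3142_iff {n : ℕ} (w : Fin n → Fin n) :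
    ContainsPattern w ![3, 1, 4, 2] ↔
      ∃ a b c d, a < b ∧ b < c ∧ c < d ∧ w b < w d ∧ w d < w a ∧ w a < w c := by
  constructor
  · rintro ⟨f, hf⟩
    have h1 := hf 1 3
    have h2 := hf 3 0
    have h3 := hf 0 2
    simp at h1 h2 h3
    exact ⟨f 0, f 1, f 2, f 3, f.strictMono (by decide), f.strictMono (by decide),
      f.strictMono (by decide), h1, h2, h3⟩
  · rintro ⟨a, b, c, d, hab, hbc, hcd, h1, h2, h3⟩
    refine ⟨OrderEmbedding.ofStrictMono ![a, b, c, d] ?_, ?_⟩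
    · rw [Fin.strictMono_iff_lt_succ]
      intro i
      fin_cases i <;> simp [hab, hbc, hcd]
    · intro i j
      fin_cases i <;> fin_cases j <;> simp <;> order

/-- Let `π j` be the largest value below `π i` to the right of an ascent bottom `i`. By maximality
the value `π j + 1` sits at some `k ≤ i`. If `k = i`, this is a Fishburn pattern. If `k < i`, then
`k` must be a descent, and `k, k + 1, i, j` form 3142. -/
theorem IsFishburn.hasMinimalAscentBottoms {n : ℕ} {π : Equiv.Perm (Fin n)} (hπ : IsFishburn π)
    (h : ¬ ContainsPattern π ![3, 1, 4, 2]) : HasMinimalAscentBottoms π := by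
  intro i i' hii' hasc
  by_contra! hcon
  obtain ⟨h₀, hih₀, hle₀⟩ := hcon
  obtain ⟨j, hj, hmax⟩ := (Finset.univ.filter fun j => i < j ∧ π j < π i).exists_max_image π
    ⟨h₀, by simpa [hih₀] using lt_of_le_of_ne hle₀ (π.injective.ne hih₀.ne')⟩
  simp only [Finset.mem_filter, Finset.mem_univ, true_and] at hj hmax
  obtain ⟨hij, hji⟩ := hj
  have hi'j : i' < j := by
    have hne : i' ≠ j := by rintro rfl; exact lt_asymm hji hasc
    rw [Fin.lt_def] at hij ⊢
    have := Fin.val_ne_of_ne hne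
    omega
  obtain ⟨k, hk⟩ : ∃ k, (π k : ℕ) = π j + 1 := by
    refine ⟨π.symm ⟨π j + 1, ?_⟩, by simp⟩
    rw [Fin.lt_def] at hji
    omega
  have hki : k ≤ i := by
    by_contra! hik
    by_cases hlt : π k < π i
    · have := hmax k ⟨hik, hlt⟩
      rw [Fin.le_def] at this
      omega
    · have : π k = π i := by
        apply Fin.ext
        rw [Fin.lt_def] at hlt hji
        omega
      exact hik.ne' (π.injective this)
  rcases hki.eq_or_lt with rfl | hki
  · exact hπ ⟨k, i', j, hii', hi'j, hk.symm, hasc⟩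
  have hk'n : (k : ℕ) + 1 < n := by rw [Fin.lt_def] at hki; omega
  have hk'i : (⟨k + 1, hk'n⟩ : Fin n) ≤ i := hki
  have hdesc : π ⟨k + 1, hk'n⟩ < π k := by
    by_contra! hle
    refine hπ ⟨k, ⟨k + 1, hk'n⟩, j, rfl, hk'i.trans_lt hij, hk.symm, lt_of_le_of_ne hle ?_⟩
    exact π.injective.ne (by simp [Fin.ext_iff])
  have hne : π ⟨k + 1, hk'n⟩ ≠ π j := π.injective.ne (hk'i.trans_lt hij).ne
  have hne' : π k ≠ π i := π.injective.ne hki.ne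
  refine h ((containsPattern_3142_iff π).2
    ⟨k, ⟨k + 1, hk'n⟩, i, j, by simp [Fin.lt_def], lt_of_le_of_ne hk'i ?_, hij, ?_, ?_, ?_⟩)
  · rintro rfl
    rw [Fin.lt_def] at hji hdesc
    omega
  all_goals
    have := Fin.val_ne_of_ne hne
    have := Fin.val_ne_of_ne hne'
    rw [Fin.lt_def] at *
    omega

/-- An ascent bottom is the first place where `α` takes its value, and a restricted growth function
takes this value before any larger one. -/
theorem IsRGF.hasMinimalAscentBottoms {n : ℕ} {α : Fin n → ℕ} (hα : IsRGF α) :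
    HasMinimalAscentBottoms (transposition α) := by
  intro i i' hii' hasc h hih
  have hi'h : i' ≤ h := by rw [Fin.lt_def] at hih; rw [Fin.le_def]; omega
  have hlt : α (transposition α i) < α (transposition α i') :=
    (transposition_spec α (show i < i' by rw [Fin.lt_def]; omega)).resolve_right
      fun hcon => lt_asymm hasc hcon.2
  obtain ⟨j, hj, hjv⟩ := hα _ _ (hlt.trans_le (transposition_monotone α hi'h))
  obtain ⟨k, rfl⟩ := (transposition α).surjective j
  have hki : k ≤ i := by
    by_contra! hik
    have := transposition_monotone α (show i' ≤ k by
      rw [Fin.lt_def] at hik; rw [Fin.le_def]; omega)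
    simp only [Function.comp_apply] at this
    omega
  rcases hki.eq_or_lt with rfl | hki
  · exact hj
  · rcases transposition_spec α hki with hlt' | ⟨-, hlt'⟩
    · omega
    · exact hlt'.trans hj

/-- If `p < q < s` is a 101, the value `α q` occurs at some `o < p`, and the word shows `q, o, s, p`
in this order. Conversely, in a 3142 the letter 4 lies in a later run than 3, and the run of 4 has a
letter below 3, because 2 lies in that run or a later one. -/
theorem IsRGF.not_containsPattern_3142_iff {n : ℕ} {α : Fin n → ℕ} (hα : IsRGF α) :
    ¬ ContainsPattern (transposition α) ![3, 1, 4, 2] ↔ Avoids101 α := by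
  rw [containsPattern_3142_iff]
  constructor
  · intro h p q s hpq hqs hps hlt
    obtain ⟨o, hop, hoq⟩ := hα p _ hlt
    refine h ⟨_, _, _, _, (transposition_symm_lt_iff α q o).2 (.inr ⟨hoq.symm, hop.trans hpq⟩),
      (transposition_symm_lt_iff α o s).2 (.inl (by omega)),
      (transposition_symm_lt_iff α s p).2 (.inr ⟨hps.symm, hpq.trans hqs⟩), ?_⟩
    simpa using ⟨hop, hpq, hqs⟩
  · rintro h ⟨c, a, d, b, hca, had, hdb, h1, h2, h3⟩
    have hcd : α (transposition α c) < α (transposition α d) := by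
      refine ((transposition_spec α had).resolve_right
        fun hcon => lt_asymm (h1.trans (h2.trans h3)) hcon.2).trans_le' ?_
      exact transposition_monotone α hca.le
    obtain ⟨e, he, hev⟩ : ∃ e < transposition α c, α e = α (transposition α d) := by
      rcases transposition_spec α hdb with hlt | heq
      · obtain ⟨e, he, hev⟩ := hα _ _ hlt
        exact ⟨e, he.trans h2, hev⟩
      · exact ⟨_, h2, heq.1.symm⟩
    exact h e _ _ he h3 hev (by omega)

/-! ### Descending runs and the inverse of the transposition. -/

theorem ascPrefix_one {n : ℕ} (α : Fin n → ℕ) : ascPrefix α 1 = 0 := by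
  simp [ascPrefix]

theorem ascPrefix_succ {n : ℕ} (α : Fin n → ℕ) (m : ℕ) :
    ascPrefix α (m + 2) = ascPrefix α (m + 1) + if IsAscent α m then 1 else 0 := by
  split_ifs with h
  · have hm : m < n := by obtain ⟨h, -⟩ := h; omega
    rw [ascPrefix, ascPrefix, ← Finset.card_insert_of_notMem (a := m) (by simp)]
    congr 1
    ext j
    simp only [Finset.mem_filter, Finset.mem_range, Finset.mem_insert]
    constructor
    · rintro ⟨h1, h2, h3⟩
      by_cases hjm : j = m
      · exact .inl hjm
      · exact .inr ⟨h1, by omega, h3⟩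
    · rintro (rfl | ⟨h1, h2, h3⟩)
      · exact ⟨hm, by omega, h⟩
      · exact ⟨h1, by omega, h3⟩
  · rw [ascPrefix, ascPrefix, add_zero]
    congr 1
    ext j
    simp only [Finset.mem_filter, Finset.mem_range]
    constructor
    · rintro ⟨h1, h2, h3⟩
      have hjm : j ≠ m := by rintro rfl; exact h h3
      exact ⟨h1, by omega, h3⟩
    · rintro ⟨h1, h2, h3⟩
      exact ⟨h1, by omega, h3⟩

theorem isAscent_perm_iff {n : ℕ} (π : Equiv.Perm (Fin n)) {m : ℕ} (hm : m + 1 < n) :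
    IsAscent (fun i => (π i : ℕ)) m ↔ π ⟨m, Nat.lt_of_succ_lt hm⟩ < π ⟨m + 1, hm⟩ :=
  ⟨fun h => h.2, fun h => ⟨hm, h⟩⟩

/-- The entry of `α` at `π k` is the index of the descending run of `π = 𝒯(α)` through
position `k`. -/
theorem IsRGF.apply_transposition {n : ℕ} {α : Fin n → ℕ} (hα : IsRGF α) (k : ℕ) (hk : k < n) :
    α (transposition α ⟨k, hk⟩) = ascPrefix (fun i => (transposition α i : ℕ)) (k + 1) := by
  induction k with
  | zero =>
    rw [ascPrefix_one]
    by_contra hne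
    obtain ⟨j, hj, hjv⟩ := hα _ 0 (Nat.pos_of_ne_zero hne)
    obtain ⟨k, rfl⟩ := (transposition α).surjective j
    have := transposition_monotone α (show ⟨0, hk⟩ ≤ k from Nat.zero_le _)
    simp only [Function.comp_apply] at this
    omega
  | succ k ih =>
    have hlt : (⟨k, Nat.lt_of_succ_lt hk⟩ : Fin n) < ⟨k + 1, hk⟩ := by simp [Fin.lt_def]
    rw [ascPrefix_succ, ← ih (Nat.lt_of_succ_lt hk)]
    split_ifs with h
    · rw [isAscent_perm_iff _ hk] at h
      have h' := (transposition_spec α hlt).resolve_right fun hcon => lt_asymm h hcon.2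
      refine le_antisymm ?_ h'
      -- A skipped value would have to occur, but the sorted entries leave no place for it.
      by_contra! hgt
      obtain ⟨j, hj, hjv⟩ := hα _ _ hgt
      obtain ⟨i, rfl⟩ := (transposition α).surjective j
      rcases Nat.lt_or_ge k i with hki | hki
      · have := transposition_monotone α (show ⟨k + 1, hk⟩ ≤ i from hki)
        simp only [Function.comp_apply] at this
        omega
      · have := transposition_monotone α (show i ≤ ⟨k, Nat.lt_of_succ_lt hk⟩ from hki)
        simp only [Function.comp_apply] at this
        omega
    · rw [isAscent_perm_iff _ hk] at h
      rcases transposition_spec α hlt with hcon | heq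
      -- If the entry grew, its old value would occur at a letter `j` below the new one; `j` is no
      -- smaller than the last letter of its run, so there would be an ascent.
      · obtain ⟨j, hj, hjv⟩ := hα _ _ hcon
        obtain ⟨i, rfl⟩ := (transposition α).surjective j
        exfalso
        rcases lt_trichotomy i ⟨k, Nat.lt_of_succ_lt hk⟩ with hik | rfl | hik
        · rcases transposition_spec α hik with h1 | h1
          · omega
          · exact h (h1.2.trans hj)
        · exact h hj
        · have := transposition_monotone α (show ⟨k + 1, hk⟩ ≤ i from hik)
          simp only [Function.comp_apply] at this
          omega
      · exact heq.1.symm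

theorem transposition_injOn_isRGF (n : ℕ) :
    Set.InjOn (transposition (n := n)) {α | IsRGF α} := by
  intro α hα β hβ h
  funext x
  obtain ⟨k, rfl⟩ := (transposition α).surjective x
  rw [hα.apply_transposition k k.2]
  rw [h, hβ.apply_transposition k k.2]

/-- The index of the descending run of `π` that contains the value `x`. -/
def runIndex {n : ℕ} (π : Equiv.Perm (Fin n)) (x : Fin n) : ℕ :=
  ascPrefix (fun i => (π i : ℕ)) (π.symm x + 1)

/-- The run index is constant at descents and grows at ascents, so the columns are already sorted
along `π`. -/
theorem transposition_runIndex {n : ℕ} (π : Equiv.Perm (Fin n)) :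
    transposition (runIndex π) = π := by
  have key : ∀ (j : ℕ) (hj : j < n) (i : Fin n), (i : ℕ) < j →
      runIndex π (π i) < runIndex π (π ⟨j, hj⟩) ∨
        runIndex π (π i) = runIndex π (π ⟨j, hj⟩) ∧ π ⟨j, hj⟩ < π i := by
    intro j
    induction j with
    | zero => intro _ i hi; omega
    | succ j ih =>
      intro hj i hi
      have hj' : j < n := by omega
      have hstep : runIndex π (π ⟨j + 1, hj⟩) = runIndex π (π ⟨j, hj'⟩) +
          if IsAscent (fun i => (π i : ℕ)) j then 1 else 0 := by
        simp only [runIndex, Equiv.symm_apply_apply]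
        exact ascPrefix_succ _ _
      simp only [isAscent_perm_iff π hj] at hstep
      have hne : π ⟨j, hj'⟩ ≠ π ⟨j + 1, hj⟩ := π.injective.ne (by simp)
      have hij : (i : ℕ) < j ∨ i = ⟨j, hj'⟩ := by
        rcases (Nat.lt_succ_iff.1 hi).lt_or_eq with h | h
        · exact .inl h
        · exact .inr (Fin.ext h)
      split_ifs at hstep with hasc
      · left
        rcases hij with hij | rfl
        · rcases ih hj' i hij with h | h <;> omega
        · omega
      · have hlt : π ⟨j + 1, hj⟩ < π ⟨j, hj'⟩ := lt_of_le_of_ne (not_lt.1 hasc) hne.symm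
        rcases hij with hij | rfl
        · rcases ih hj' i hij with h | h
          · left; omega
          · exact .inr ⟨by omega, hlt.trans h.2⟩
        · exact .inr ⟨by omega, hlt⟩
  exact (eq_transposition fun i j hij => key j j.2 i hij).symm

/-- Run `v` ends in an ascent bottom, which is smaller than every letter of a later run. -/
theorem HasMinimalAscentBottoms.isRGF_runIndex {n : ℕ} {π : Equiv.Perm (Fin n)}
    (hπ : HasMinimalAscentBottoms π) : IsRGF (runIndex π) := by
  have key : ∀ (j : ℕ) (hj : j < n) (v : ℕ), v < ascPrefix (fun i => (π i : ℕ)) (j + 1) →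
      ∃ k, ∃ hk : k + 1 < n, k < j ∧ π ⟨k, Nat.lt_of_succ_lt hk⟩ < π ⟨k + 1, hk⟩ ∧
        ascPrefix (fun i => (π i : ℕ)) (k + 1) = v := by
    intro j
    induction j with
    | zero => intro _ v hv; rw [ascPrefix_one] at hv; omega
    | succ j ih =>
      intro hj v hv
      by_cases hv' : v < ascPrefix (fun i => (π i : ℕ)) (j + 1)
      · obtain ⟨k, hk, hkj, h⟩ := ih (by omega) v hv'
        exact ⟨k, hk, by omega, h⟩
      · rw [ascPrefix_succ] at hv
        split_ifs at hv with hasc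
        · exact ⟨j, hj, by omega, (isAscent_perm_iff π hj).1 hasc, by omega⟩
        · omega
  intro x v hv
  obtain ⟨k, hk, hkj, hasc, hkv⟩ := key _ (π.symm x).2 v hv
  refine ⟨π ⟨k, Nat.lt_of_succ_lt hk⟩, ?_, by simpa [runIndex] using hkv⟩
  simpa using hπ _ _ rfl hasc (π.symm x) hkj

theorem transposition_bijOn (n : ℕ) :
    Set.BijOn (transposition (n := n)) {α | IsRGF α ∧ Avoids101 α}
      {π | IsFishburn π ∧ ¬ ContainsPattern π ![3, 1, 4, 2]} := by
  refine ⟨?_, (transposition_injOn_isRGF n).mono fun α hα => hα.1, ?_⟩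
  · rintro α ⟨hα, h⟩
    exact ⟨hα.hasMinimalAscentBottoms.isFishburn, hα.not_containsPattern_3142_iff.2 h⟩
  · rintro π ⟨hπ, h⟩
    have hrgf := (hπ.hasMinimalAscentBottoms h).isRGF_runIndex
    refine ⟨runIndex π, ⟨hrgf, hrgf.not_containsPattern_3142_iff.1 ?_⟩, transposition_runIndex π⟩
    rwa [transposition_runIndex]

/-! ### Interval orders with all points -/

namespace FinPoset

variable {V : Type} [LinearOrder V]

/-- `P` is the interval order of the intervals `[ℓ x, r x]` of natural numbers, where every
point up to the largest endpoint occurs as an interval `[j, j]`. -/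
structure IsPointed (P : FinPoset V) (ℓ r : V → ℕ) : Prop where
  lt_iff : ∀ x y, P.lt x y ↔ x ∈ P.carrier ∧ y ∈ P.carrier ∧ r x < ℓ y
  le : ∀ x ∈ P.carrier, ℓ x ≤ r x
  exists_point : ∀ x ∈ P.carrier, ∀ j ≤ r x, ∃ z ∈ P.carrier, ℓ z = j ∧ r z = j

namespace IsPointed

variable {P : FinPoset V} {ℓ r : V → ℕ}

theorem mem_down (h : P.IsPointed ℓ r) {x z : V} (hx : x ∈ P.carrier) :
    z ∈ P.down x ↔ z ∈ P.carrier ∧ r z < ℓ x := by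
  simp only [down, Finset.mem_filter, h.lt_iff]
  tauto

/-- If `ℓ y < ℓ x`, the point at `ℓ y` lies below `x` but not below `y`. -/
theorem down_subset_down_iff (h : P.IsPointed ℓ r) {x y : V} (hx : x ∈ P.carrier)
    (hy : y ∈ P.carrier) : P.down x ⊆ P.down y ↔ ℓ x ≤ ℓ y := by
  constructor
  · intro hsub
    by_contra! hlt
    obtain ⟨z, hz, -, hzr⟩ := h.exists_point x hx (ℓ y) (hlt.le.trans (h.le x hx))
    have := (h.mem_down hy).1 (hsub ((h.mem_down hx).2 ⟨hz, by omega⟩))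
    omega
  · intro hle z hz
    rw [h.mem_down hx] at hz
    rw [h.mem_down hy]
    exact ⟨hz.1, by omega⟩

theorem level_eq (h : P.IsPointed ℓ r) {x : V} (hx : x ∈ P.carrier) : P.level x = ℓ x := by
  rw [level, ← Finset.card_range (ℓ x)]
  symm
  have hpt : ∀ j, j < ℓ x → ∃ z ∈ P.carrier, ℓ z = j := fun j hj => by
    obtain ⟨z, hz, hzl, -⟩ := h.exists_point x hx j (hj.le.trans (h.le x hx))
    exact ⟨z, hz, hzl⟩
  choose z hz hzl using hpt
  refine Finset.card_bij (fun j hj => P.down (z j (Finset.mem_range.1 hj))) ?_ ?_ ?_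
  · intro j hj
    rw [Finset.mem_filter, Finset.ssubset_def, h.down_subset_down_iff (hz _ _) hx,
      h.down_subset_down_iff hx (hz _ _), hzl]
    rw [Finset.mem_range] at hj
    exact ⟨Finset.mem_image_of_mem _ (hz _ _), hj.le, by omega⟩
  · intro i hi j hj hij
    have h1 := (h.down_subset_down_iff (hz _ _) (hz _ _)).1 hij.subset
    have h2 := (h.down_subset_down_iff (hz _ _) (hz _ _)).1 hij.symm.subset
    simp only [hzl] at h1 h2
    omega
  · intro d hd
    obtain ⟨hd, hdx⟩ := Finset.mem_filter.1 hd
    obtain ⟨y, hy, rfl⟩ := Finset.mem_image.1 hd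
    rw [Finset.ssubset_def, h.down_subset_down_iff hy hx, h.down_subset_down_iff hx hy] at hdx
    refine ⟨ℓ y, Finset.mem_range.2 (by omega), Finset.Subset.antisymm ?_ ?_⟩
    · rw [h.down_subset_down_iff (hz _ _) hy, hzl]
    · rw [h.down_subset_down_iff hy (hz _ _), hzl]

/-- If `r x < r z`, the point at `r z` lies above `x`. -/
theorem mem_maximals (h : P.IsPointed ℓ r) {x : V} :
    x ∈ P.maximals ↔ x ∈ P.carrier ∧ ∀ z ∈ P.carrier, r z ≤ r x := by
  simp only [maximals, Finset.mem_filter, h.lt_iff]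
  constructor
  · rintro ⟨hx, hmax⟩
    refine ⟨hx, fun z hz => ?_⟩
    obtain ⟨w, hw, hwl, -⟩ := h.exists_point z hz (r z) le_rfl
    have := hmax w hw
    simp only [hx, hw, true_and] at this
    omega
  · rintro ⟨hx, hmax⟩
    refine ⟨hx, fun z hz hlt => ?_⟩
    have := hmax z hz
    have := h.le z hz
    omega

/-- The element removed first: among those with the largest right endpoint it has the smallest left
endpoint. Nothing is freed, so that the rest is the induced interval order. -/
theorem exists_remove_eq (h : P.IsPointed ℓ r) (hne : P.carrier.Nonempty) :
    ∃ y ∈ P.carrier, (∀ z ∈ P.carrier, r z ≤ r y ∧ (r z = r y → ℓ y ≤ ℓ z)) ∧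
      P.minMaxLevel = ℓ y ∧ P.remove.carrier = P.carrier.erase y ∧
      P.remove.IsPointed ℓ r := by
  obtain ⟨t, ht, htmax⟩ := P.carrier.exists_max_image r hne
  have hmaxne : P.maximals.Nonempty := ⟨t, h.mem_maximals.2 ⟨ht, htmax⟩⟩
  have himg : (P.maximals.image P.level).Nonempty := hmaxne.image _
  have hmin : ((P.minMaxLevel : ℕ) : WithTop ℕ) = (P.maximals.image P.level).min := by
    obtain ⟨a, ha⟩ := Finset.min_of_nonempty himg
    rw [minMaxLevel, ha]
    rfl
  have hmem : P.minMaxLevel ∈ P.maximals.image P.level := Finset.mem_of_min hmin.symm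
  have hfil : (P.maximals.filter fun x => P.level x = P.minMaxLevel).Nonempty := by
    obtain ⟨x, hx, hxl⟩ := Finset.mem_image.1 hmem
    exact ⟨x, Finset.mem_filter.2 ⟨hx, hxl⟩⟩
  obtain ⟨y, hy⟩ := Finset.min_of_nonempty hfil
  obtain ⟨hymax, hylev⟩ := Finset.mem_filter.1 (Finset.mem_of_min hy)
  obtain ⟨hyP, hyr⟩ := h.mem_maximals.1 hymax
  have hrem : P.remove = P.removeAt y := by
    rw [remove, hy]
  rw [h.level_eq hyP] at hylev
  have hyl : ∀ z ∈ P.carrier, r z = r y → ℓ y ≤ ℓ z := by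
    intro z hz hzr
    have hzmax : z ∈ P.maximals := h.mem_maximals.2 ⟨hz, by rwa [hzr]⟩
    have := Finset.min_le (Finset.mem_image_of_mem P.level hzmax)
    rw [← hmin, h.level_eq hz] at this
    exact hylev.le.trans (WithTop.coe_le_coe.1 this)
  -- If `y` is alone on its level, it is the point at `ℓ y`. This is then the largest endpoint, so
  -- the next level is empty.
  have hfreed : P.freed y = ∅ := by
    rw [freed]
    split_ifs with hsing
    · obtain ⟨z, hz, hzl, hzr⟩ := h.exists_point y hyP (ℓ y) (h.le y hyP)
      have hzy : z ∈ P.levelSet (P.level y) := by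
        rw [levelSet, Finset.mem_filter, h.level_eq hz, h.level_eq hyP]
        exact ⟨hz, hzl⟩
      rw [hsing, Finset.mem_singleton] at hzy
      subst hzy
      refine Finset.eq_empty_of_forall_notMem fun v hv => ?_
      obtain ⟨w, hw, -⟩ := Finset.mem_biUnion.1 hv
      rw [levelSet, Finset.mem_filter, h.level_eq hz] at hw
      rw [h.level_eq hw.1] at hw
      have := hyr w hw.1
      have := h.le w hw.1
      omega
    · rfl
  refine ⟨y, hyP, fun z hz => ⟨hyr z hz, hyl z hz⟩, hylev.symm, by rw [hrem]; rfl, ?_⟩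
  rw [hrem]
  refine ⟨fun u v => ?_, fun x hx => h.le x (Finset.mem_of_mem_erase hx), fun x hx j hj => ?_⟩
  · simp only [removeAt, hfreed, h.lt_iff, Finset.mem_erase, Finset.notMem_empty]
    tauto
  · obtain ⟨hxy, hxP⟩ := Finset.mem_erase.1 hx
    obtain ⟨z, hz, hzl, hzr⟩ := h.exists_point x hxP j hj
    -- If the point at `j` was removed, then `r x = j` is the largest right endpoint, and the choice
    -- of `y` forces `ℓ x = j`: `x` is another copy of the point.
    by_cases hzy : z = y
    · subst hzy
      have h1 := hyr x hxP
      have h2 := hyl x hxP (by omega)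
      have h3 := h.le x hxP
      exact ⟨x, hx, by omega, by omega⟩
    · exact ⟨z, Finset.mem_erase.2 ⟨hzy, hz⟩, hzl, hzr⟩

/-- The sequence of such an interval order lists the left endpoints, sorted by increasing right
endpoints and then by decreasing left endpoints. -/
theorem exists_toSeq_eq (n : ℕ) : ∀ (P : FinPoset V) (_ : P.IsPointed ℓ r)
    (hn : P.carrier.card = n), ∃ σ : Fin n → V, Function.Injective σ ∧
      (∀ i, σ i ∈ P.carrier) ∧ (∀ i, P.toSeq n hn i = ℓ (σ i)) ∧
      ∀ i j, i < j → r (σ i) ≤ r (σ j) ∧ (r (σ i) = r (σ j) → ℓ (σ j) ≤ ℓ (σ i)) := by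
  induction n with
  | zero =>
    intro P h hn
    exact ⟨Fin.elim0, fun i => i.elim0, fun i => i.elim0, fun i => i.elim0, fun i => i.elim0⟩
  | succ n ih =>
    intro P h hn
    obtain ⟨y, hy, hmax, hlev, hcar, hrem⟩ :=
      h.exists_remove_eq (Finset.card_pos.1 (by omega))
    have hcard : P.remove.carrier.card = n := by
      rw [hcar, Finset.card_erase_of_mem hy, hn]
      rfl
    obtain ⟨σ, hinj, hmem, hseq, hsort⟩ := ih P.remove hrem hcard
    rw [hcar] at hmem
    have hσ : ∀ i, σ i ≠ y ∧ σ i ∈ P.carrier := fun i => Finset.mem_erase.1 (hmem i)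
    refine ⟨Fin.snoc (α := fun _ => V) σ y, ?_, ?_, ?_, ?_⟩
    · rw [Fin.snoc_injective_iff]
      exact ⟨hinj, by rintro ⟨i, hi⟩; exact (hσ i).1 hi⟩
    · intro i
      refine Fin.lastCases ?_ (fun i => ?_) i
      · simpa using hy
      · simpa using (hσ i).2
    · intro i
      refine Fin.lastCases ?_ (fun i => ?_) i
      · simp [toSeq, hlev]
      · rw [Fin.snoc_castSucc, ← hseq i]
        simp only [toSeq, Fin.val_castSucc]
        rw [show n + 1 - 1 - (i : ℕ) = (n - 1 - i) + 1 by omega, Function.iterate_succ_apply]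
    · intro i j
      refine Fin.lastCases ?_ (fun j => ?_) j
      · refine Fin.lastCases ?_ (fun i => ?_) i
        · intro hij
          exact absurd hij (lt_irrefl _)
        · intro _
          simpa using hmax _ (hσ i).2
      · refine Fin.lastCases ?_ (fun i => ?_) i
        · intro hij
          exact absurd hij (Fin.castSucc_lt_last j).not_gt
        · intro hij
          simpa using hsort i j (Fin.castSucc_lt_castSucc_iff.1 hij)

end IsPointed

end FinPoset

/-! ### Families of intervals -/

/-- Intervals `[ℓ i, r i]` of natural numbers in lexicographic order such that any two are nested or
disjoint, and every point up to the largest endpoint occurs as an interval `[j, j]`. -/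
structure IsLaminarFamily {n : ℕ} (ℓ r : Fin n → ℕ) : Prop where
  le : ∀ i, ℓ i ≤ r i
  lex : ∀ i j, i < j → ℓ i ≤ ℓ j ∧ (ℓ i = ℓ j → r i ≤ r j)
  exists_point : ∀ i, ∀ j ≤ r i, ∃ k, ℓ k = j ∧ r k = j
  noncrossing : ∀ i j, ℓ i < ℓ j → ℓ j ≤ r i → ¬ r i < r j

namespace Matching

variable {n : ℕ}

/-- The endpoints of `M` appear in the order of the numbers `ℓ i` (for openers) and `r i` (for
closers), openers before closers at the same number, and earlier arcs first. -/
structure Represents (M : Matching n) (ℓ r : Fin n → ℕ) : Prop where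
  closer_lt_opener : ∀ i j, M.closer i < M.opener j ↔ r i < ℓ j
  closer_lt_closer : ∀ i j, M.closer i < M.closer j ↔ r i < r j ∨ r i = r j ∧ i < j

theorem opener_ne_closer (M : Matching n) (i j : Fin n) : M.opener i ≠ M.closer j := fun h =>
  Sum.inl_ne_inr (M.endpoints_bijective.1 (a₁ := .inl i) (a₂ := .inr j) h)

theorem closer_injective (M : Matching n) : Function.Injective M.closer := fun i j h =>
  Sum.inr_injective (M.endpoints_bijective.1 (a₁ := .inr i) (a₂ := .inr j) h)

theorem opener_lt_closer_iff (M : Matching n) (i j : Fin n) :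
    M.opener i < M.closer j ↔ ¬ M.closer j < M.opener i :=
  ⟨fun h => h.not_gt, fun h => lt_of_le_of_ne (not_lt.1 h) (M.opener_ne_closer i j)⟩

theorem exists_eq_opener_or_closer (M : Matching n) (p : ℕ) (hp : p < 2 * n) :
    (∃ i, (M.opener i : ℕ) = p) ∨ ∃ i, (M.closer i : ℕ) = p := by
  obtain ⟨i | i, h⟩ := M.endpoints_bijective.2 ⟨p, hp⟩
  · exact .inl ⟨i, congrArg Fin.val h⟩
  · exact .inr ⟨i, congrArg Fin.val h⟩

namespace Represents

variable {M : Matching n} {ℓ r : Fin n → ℕ}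

theorem opener_lt_closer (h : M.Represents ℓ r) (i j : Fin n) :
    M.opener i < M.closer j ↔ ℓ i ≤ r j := by
  rw [opener_lt_closer_iff, h.closer_lt_opener, not_lt]

/-- The numbers fix the relative order of all endpoints, and the only monotone permutation of `Fin
(2 * n)` is the identity. -/
theorem unique {M' : Matching n} (h : M.Represents ℓ r) (h' : M'.Represents ℓ r) : M = M' := by
  have key : ∀ s t, Sum.elim M.opener M.closer s < Sum.elim M.opener M.closer t ↔
      Sum.elim M'.opener M'.closer s < Sum.elim M'.opener M'.closer t := by
    rintro (i | i) (j | j)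
    · simp [M.opener_strictMono.lt_iff_lt, M'.opener_strictMono.lt_iff_lt]
    · simp [h.opener_lt_closer, h'.opener_lt_closer]
    · simp [h.closer_lt_opener, h'.closer_lt_opener]
    · simp [h.closer_lt_closer, h'.closer_lt_closer]
  let e := Equiv.ofBijective _ M.endpoints_bijective
  let e' := Equiv.ofBijective _ M'.endpoints_bijective
  have hmono : StrictMono (e.symm.trans e') := by
    intro p q hpq
    obtain ⟨s, rfl⟩ := e.surjective p
    obtain ⟨t, rfl⟩ := e.surjective q
    simpa [e, e'] using (key s t).1 hpq
  have hid := (Equiv.Perm.monotone_iff _).1 hmono.monotone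
  have hval : ∀ s, Sum.elim M.opener M.closer s = Sum.elim M'.opener M'.closer s := by
    intro s
    have := Equiv.congr_fun hid (e s)
    simpa [e, e'] using this.symm
  have h1 : M.opener = M'.opener := funext fun i => hval (.inl i)
  have h2 : M.closer = M'.closer := funext fun i => hval (.inr i)
  cases M
  cases M'
  simp only at h1 h2
  subst h1 h2
  rfl

theorem isPointed (h : M.Represents ℓ r) (hf : IsLaminarFamily ℓ r) :
    M.toPoset.IsPointed ℓ r where
  lt_iff i j := by simp [toPoset, h.closer_lt_opener]
  le i _ := hf.le i
  exists_point i _ j hj := by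
    obtain ⟨k, hk⟩ := hf.exists_point i j hj
    exact ⟨k, Finset.mem_univ _, hk⟩

/-- If the left endpoints of nested arcs differ, a closer at the smaller one separates the openers;
dually for closers. Ties are excluded by the order of the indices. -/
theorem isStoimenow (h : M.Represents ℓ r) (hf : IsLaminarFamily ℓ r) : M.IsStoimenow := by
  constructor
  · intro i j hadj hlt
    have hij : i < j := by
      rw [← M.opener_strictMono.lt_iff_lt, Fin.lt_def]
      omega
    rw [h.closer_lt_closer] at hlt
    have hlex := hf.lex i j hij
    by_cases hℓ : ℓ i = ℓ j
    · have := hlex.2 hℓ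
      omega
    · obtain ⟨k, -, hk⟩ := hf.exists_point i (ℓ i) (hf.le i)
      have h1 := (h.opener_lt_closer i k).2 hk.ge
      have h2 := (h.closer_lt_opener k j).2 (by omega)
      rw [Fin.lt_def] at h1 h2
      omega
  · intro i j hadj hlt
    have hji : M.closer j < M.closer i := by
      rw [Fin.lt_def]
      omega
    rw [M.opener_strictMono.lt_iff_lt] at hlt
    rcases (h.closer_lt_closer j i).1 hji with hr | hr
    · obtain ⟨k, hk, -⟩ := hf.exists_point i (r i) le_rfl
      have h1 := (h.opener_lt_closer k i).2 hk.le
      have h2 := (h.closer_lt_opener j k).2 (by omega)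
      rw [Fin.lt_def] at h1 h2
      omega
    · exact lt_asymm hlt hr.2

/-- The two middle arcs of P₂ cross as intervals: the first arc closes between their openers, and
the last opens between their closers. -/
theorem not_contains_patternP2 (h : M.Represents ℓ r)
    (hf : ∀ i j, ℓ i < ℓ j → ℓ j ≤ r i → ¬ r i < r j) : ¬ M.Contains patternP2 := by
  rintro ⟨f, hf'⟩
  have h1 := (hf' 1 0).2
  have h2 := (hf' 2 0).2
  have h3 := (hf' 2 1).2
  have h4 := (hf' 3 1).2
  have h5 := (hf' 3 2).2
  simp only [h.opener_lt_closer] at h1 h2 h3 h4 h5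
  simp [patternP2] at h1 h2 h3 h4 h5
  refine hf (f 1) (f 2) ?_ ?_ ?_ <;> omega

theorem noncrossing (h : M.Represents ℓ r) (hle : ∀ i, ℓ i ≤ r i)
    (hl : ∀ i, ∀ j ≤ r i, ∃ k, ℓ k = j) (hr : ∀ i, ∀ j ≤ r i, ∃ k, r k = j)
    (hlex : ∀ i j, i < j → ℓ i ≤ ℓ j ∧ (ℓ i = ℓ j → r i ≤ r j))
    (hP : ¬ M.Contains patternP2) (i j : Fin n) (h1 : ℓ i < ℓ j) (h2 : ℓ j ≤ r i) :
    ¬ r i < r j := by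
  intro h3
  -- The outer arcs of P₂: `a` ends where `i` starts, and `d` starts where `j` ends.
  obtain ⟨a, ha⟩ := hr i (ℓ i) (hle i)
  obtain ⟨d, hd⟩ := hl j (r j) le_rfl
  have hlt : ∀ s t, (ℓ s < ℓ t ∨ ℓ s = ℓ t ∧ r s < r t) → s < t := by
    intro s t hst
    by_contra! hts
    rcases hts.eq_or_lt with rfl | hts
    · omega
    · have := hlex t s hts
      omega
  have hla := hle a
  have hld := hle d
  have hai : a < i := hlt a i (by omega)
  have hij : i < j := hlt i j (by omega)
  have hjd : j < d := hlt j d (by omega)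
  refine hP ⟨OrderEmbedding.ofStrictMono ![a, i, j, d] ?_, ?_⟩
  · rw [Fin.strictMono_iff_lt_succ]
    intro i
    fin_cases i <;> simp [hai, hij, hjd]
  · intro s t
    simp only [h.opener_lt_closer, h.closer_lt_closer]
    fin_cases s <;> fin_cases t <;> simp [patternP2] <;> omega

end Represents

/-! ### Every family of intervals comes from a matching -/

/-- The endpoints of the intervals, in the order required by `Represents`. -/
def endpointKey (ℓ r : Fin n → ℕ) : Fin n ⊕ Fin n → ℕ ×ₗ ℕ ×ₗ Fin n :=
  Sum.elim (fun i => toLex (ℓ i, toLex (0, i))) fun i => toLex (r i, toLex (1, i))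

theorem endpointKey_injective (ℓ r : Fin n → ℕ) : Function.Injective (endpointKey ℓ r) := by
  rintro (i | i) (j | j) h <;> simp [endpointKey] at h ⊢
  · exact h.2
  · exact h.2

theorem exists_represents {ℓ r : Fin n → ℕ} (hle : ∀ i, ℓ i ≤ r i)
    (hlex : ∀ i j, i < j → ℓ i ≤ ℓ j) : ∃ M : Matching n, M.Represents ℓ r := by
  let e : Fin (2 * n) ≃ Fin n ⊕ Fin n := (finCongr (two_mul n)).trans finSumFinEquiv.symm
  let τ : Equiv.Perm (Fin (2 * n)) := Tuple.sort (endpointKey ℓ r ∘ e)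
  have hmono : StrictMono ((endpointKey ℓ r ∘ e) ∘ τ) :=
    (Tuple.monotone_sort _).strictMono_of_injective
      (((endpointKey_injective ℓ r).comp e.injective).comp τ.injective)
  -- `g s` is the place of the endpoint `s` in the sorted list.
  let g : Fin n ⊕ Fin n ≃ Fin (2 * n) := e.symm.trans τ.symm
  have hg : ∀ s t, g s < g t ↔ endpointKey ℓ r s < endpointKey ℓ r t := by
    intro s t
    rw [← hmono.lt_iff_lt]
    simp [g]
  have hbij : Sum.elim (fun i => g (.inl i)) (fun i => g (.inr i)) = g := by
    funext s
    cases s <;> rfl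
  refine ⟨⟨fun i => g (.inl i), fun i => g (.inr i), ?_, ?_, ?_⟩, ?_, ?_⟩
  · intro i j hij
    simp only [hg, endpointKey, Sum.elim_inl, Prod.Lex.toLex_lt_toLex]
    have := hlex i j hij
    rcases this.lt_or_eq with h | h
    · exact .inl h
    · exact .inr ⟨h, by simpa using hij⟩
  · intro i
    simp only [hg, endpointKey, Sum.elim_inl, Sum.elim_inr, Prod.Lex.toLex_lt_toLex]
    have := hle i
    rcases this.lt_or_eq with h | h
    · exact .inl h
    · exact .inr ⟨h, by simp⟩
  · rw [hbij]
    exact g.bijective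
  · intro i j
    simp [hg, endpointKey, Prod.Lex.toLex_lt_toLex]
  · intro i j
    simp [hg, endpointKey, Prod.Lex.toLex_lt_toLex]

/-! ### The intervals of a Stoimenow matching -/

/-- The number of pairs of a closer and an opener that are adjacent, up to point `p`. -/
def height (M : Matching n) (p : ℕ) : ℕ :=
  ((Finset.range p).filter fun q =>
    ∃ i j, (M.closer i : ℕ) = q ∧ (M.opener j : ℕ) = q + 1).card

theorem height_monotone (M : Matching n) : Monotone M.height := fun _ _ h =>
  Finset.card_le_card (Finset.filter_subset_filter _ (Finset.range_mono h))

theorem height_succ (M : Matching n) (p : ℕ) :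
    M.height (p + 1) = M.height p +
      if ∃ i j, (M.closer i : ℕ) = p ∧ (M.opener j : ℕ) = p + 1 then 1 else 0 := by
  rw [height, height, Finset.range_add_one, Finset.filter_insert]
  split_ifs with h
  · rw [Finset.card_insert_of_notMem (by simp)]
  · rfl

theorem exists_of_lt_height (M : Matching n) {v p : ℕ} (h : v < M.height p) :
    ∃ i j, (M.opener j : ℕ) = M.closer i + 1 ∧ M.height (M.closer i) = v ∧
      M.height (M.opener j) = v + 1 := by
  induction p with
  | zero => simp [height] at h
  | succ p ih =>
    by_cases hv : v < M.height p
    · exact ih hv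
    · have hs := M.height_succ p
      split_ifs at hs with hp
      · obtain ⟨i, j, hi, hj⟩ := hp
        refine ⟨i, j, by omega, by rw [hi]; omega, by rw [hj]; omega⟩
      · omega

/-- While the height stays constant, only closers can follow a closer. -/
theorem closer_lt_opener_iff_height (M : Matching n) (i j : Fin n) :
    M.closer i < M.opener j ↔ M.height (M.closer i) < M.height (M.opener j) := by
  refine ⟨fun hij => ?_, fun h => M.height_monotone.reflect_lt h⟩
  by_contra! hle
  have key : ∀ d : ℕ, (M.closer i : ℕ) + d ≤ M.opener j →
      ∃ k, (M.closer k : ℕ) = M.closer i + d := by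
    intro d
    induction d with
    | zero => exact fun _ => ⟨i, rfl⟩
    | succ d ih =>
      intro hd
      obtain ⟨k, hk⟩ := ih (by omega)
      rcases M.exists_eq_opener_or_closer (M.closer i + (d + 1)) (by omega) with ⟨w, hw⟩ | hw
      · have hs := M.height_succ (M.closer i + d)
        rw [if_pos ⟨k, w, hk, hw⟩] at hs
        have h1 := M.height_monotone hd
        have h2 := M.height_monotone (show (M.closer i : ℕ) ≤ M.closer i + d by omega)
        rw [← add_assoc] at h1
        omega
      · exact hw
  rw [Fin.lt_def] at hij
  obtain ⟨k, hk⟩ := key (M.opener j - M.closer i) (by omega)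
  exact M.opener_ne_closer j k (Fin.ext (by omega))

/-- Equal heights leave no closer between the two openers, so the Stoimenow condition applies along
the run of adjacent openers. -/
theorem IsStoimenow.closer_lt_closer_of_height_eq {M : Matching n} (hM : M.IsStoimenow)
    {i j : Fin n} (hij : i < j) (h : M.height (M.opener i) = M.height (M.opener j)) :
    M.closer i < M.closer j := by
  have hlt := M.opener_strictMono hij
  have key : ∀ d : ℕ, (M.opener i : ℕ) + d ≤ M.opener j →
      ∃ k, (M.opener k : ℕ) = M.opener i + d ∧ M.closer i ≤ M.closer k := by
    intro d
    induction d with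
    | zero => exact fun _ => ⟨i, rfl, le_rfl⟩
    | succ d ih =>
      intro hd
      obtain ⟨k, hk, hik⟩ := ih (by omega)
      rcases M.exists_eq_opener_or_closer (M.opener i + (d + 1)) (by omega) with ⟨w, hw⟩ | ⟨w, hw⟩
      · exact ⟨w, hw, hik.trans (not_lt.1 (hM.1 k w (by omega)))⟩
      · have hwj : M.closer w < M.opener j :=
          lt_of_le_of_ne (by rw [Fin.le_def]; omega) (M.opener_ne_closer j w).symm
        have h1 := (M.closer_lt_opener_iff_height w j).1 hwj
        have h2 := M.height_monotone (show (M.opener i : ℕ) ≤ M.closer w by omega)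
        omega
  rw [Fin.lt_def] at hlt
  obtain ⟨k, hk, hik⟩ := key (M.opener j - M.opener i) (by omega)
  obtain rfl : k = j := M.opener_strictMono.injective (Fin.ext (by omega))
  exact lt_of_le_of_ne hik (M.closer_injective.ne hij.ne)

theorem IsStoimenow.lt_of_closer_lt_closer {M : Matching n} (hM : M.IsStoimenow)
    {i j : Fin n} (hlt : M.closer i < M.closer j)
    (h : M.height (M.closer i) = M.height (M.closer j)) : i < j := by
  have key : ∀ d : ℕ, (M.closer i : ℕ) + d ≤ M.closer j →
      ∃ k, (M.closer k : ℕ) = M.closer i + d ∧ M.opener i ≤ M.opener k := by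
    intro d
    induction d with
    | zero => exact fun _ => ⟨i, rfl, le_rfl⟩
    | succ d ih =>
      intro hd
      obtain ⟨k, hk, hik⟩ := ih (by omega)
      rcases M.exists_eq_opener_or_closer (M.closer i + (d + 1)) (by omega) with ⟨w, hw⟩ | ⟨w, hw⟩
      · have h1 := (M.closer_lt_opener_iff_height i w).1 (by rw [Fin.lt_def]; omega)
        have h2 := M.height_monotone (show (M.opener w : ℕ) ≤ M.closer j by omega)
        omega
      · exact ⟨w, hw, hik.trans (not_lt.1 (hM.2 w k (by omega)))⟩
  rw [Fin.lt_def] at hlt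
  obtain ⟨k, hk, hik⟩ := key (M.closer j - M.closer i) (by omega)
  obtain rfl : k = j := M.closer_injective (Fin.ext (by omega))
  refine lt_of_le_of_ne (M.opener_strictMono.le_iff_le.1 hik) ?_
  rintro rfl
  exact lt_irrefl _ hlt

theorem IsStoimenow.represents {M : Matching n} (hM : M.IsStoimenow) :
    M.Represents (fun i => M.height (M.opener i)) fun i => M.height (M.closer i) where
  closer_lt_opener := M.closer_lt_opener_iff_height
  closer_lt_closer i j := by
    constructor
    · intro hlt
      rcases (M.height_monotone (show (M.closer i : ℕ) ≤ M.closer j from hlt.le)).lt_or_eq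
        with h | h
      · exact .inl h
      · exact .inr ⟨h, hM.lt_of_closer_lt_closer hlt h⟩
    · rintro (h | ⟨h, hij⟩)
      · exact M.height_monotone.reflect_lt h
      · by_contra! hle
        have hlt := lt_of_le_of_ne hle (M.closer_injective.ne hij.ne')
        exact lt_asymm hij (hM.lt_of_closer_lt_closer hlt h.symm)

theorem IsStoimenow.exists_represents {M : Matching n} (hM : M.IsStoimenow)
    (hP : ¬ M.Contains patternP2) :
    ∃ ℓ r, M.Represents ℓ r ∧ IsLaminarFamily ℓ r := by
  have hle : ∀ i, M.height (M.opener i) ≤ M.height (M.closer i) := fun i =>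
    M.height_monotone (M.opener_lt_closer i).le
  have hl : ∀ i, ∀ j ≤ M.height (M.closer i), ∃ k, M.height (M.opener k) = j := by
    rintro i (_ | j) hj
    · have := i.2
      rcases M.exists_eq_opener_or_closer 0 (by omega) with ⟨k, hk⟩ | ⟨k, hk⟩
      · exact ⟨k, by rw [hk]; rfl⟩
      · have := M.opener_lt_closer k
        rw [Fin.lt_def] at this
        omega
    · obtain ⟨-, k, -, -, hk⟩ := M.exists_of_lt_height hj
      exact ⟨k, hk⟩
  have hr : ∀ i, ∀ j ≤ M.height (M.closer i), ∃ k, M.height (M.closer k) = j := by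
    intro i j hj
    rcases hj.lt_or_eq with hj | hj
    · obtain ⟨k, -, -, hk, -⟩ := M.exists_of_lt_height hj
      exact ⟨k, hk⟩
    · exact ⟨i, hj.symm⟩
  have hlex : ∀ i j, i < j → M.height (M.opener i) ≤ M.height (M.opener j) ∧
      (M.height (M.opener i) = M.height (M.opener j) →
        M.height (M.closer i) ≤ M.height (M.closer j)) := fun i j hij =>
    ⟨M.height_monotone (M.opener_strictMono hij).le, fun h =>
      M.height_monotone (hM.closer_lt_closer_of_height_eq hij h).le⟩
  have hnc := hM.represents.noncrossing hle hl hr hlex hP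
  refine ⟨_, _, hM.represents, hle, hlex, fun i j hj => ?_, hnc⟩
  -- Some `s` starts at `j` and some `t` ends there; unless one of them is the point, they cross.
  obtain ⟨s, hs⟩ := hl i j hj
  obtain ⟨t, ht⟩ := hr i j hj
  have h1 := hle s
  have h2 := hle t
  have h3 := hnc t s
  by_cases h4 : M.height (M.closer s) = j
  · exact ⟨s, hs, h4⟩
  · exact ⟨t, by omega, ht⟩

end Matching

/-! ### Families of intervals and sequences -/

/-- The largest entry of `α` up to position `i`. -/
def prefixMax {n : ℕ} (α : Fin n → ℕ) (i : Fin n) : ℕ := (Finset.Iic i).sup α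

theorem le_prefixMax {n : ℕ} (α : Fin n → ℕ) {i j : Fin n} (h : j ≤ i) : α j ≤ prefixMax α i :=
  Finset.le_sup (f := α) (Finset.mem_Iic.2 h)

theorem prefixMax_monotone {n : ℕ} (α : Fin n → ℕ) : Monotone (prefixMax α) := fun _ _ h =>
  Finset.sup_mono (Finset.Iic_subset_Iic.2 h)

theorem exists_eq_prefixMax {n : ℕ} (α : Fin n → ℕ) (i : Fin n) :
    ∃ j ≤ i, α j = prefixMax α i := by
  obtain ⟨j, hj, h⟩ := Finset.exists_mem_eq_sup (Finset.Iic i) ⟨i, Finset.mem_Iic.2 le_rfl⟩ α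
  exact ⟨j, Finset.mem_Iic.1 hj, h.symm⟩

theorem IsRGF.exists_of_le_prefixMax {n : ℕ} {α : Fin n → ℕ} (hα : IsRGF α) {i : Fin n} {v : ℕ}
    (hv : v ≤ prefixMax α i) : ∃ j ≤ i, α j = v := by
  obtain ⟨k, hk, hkv⟩ := exists_eq_prefixMax α i
  rcases hv.lt_or_eq with h | h
  · obtain ⟨j, hj, hjv⟩ := hα k v (by omega)
    exact ⟨j, hj.le.trans hk, hjv⟩
  · exact ⟨k, hk, by omega⟩

/-- The list of the intervals `[ℓ (σ i), r (σ i)]` is sorted by increasing right endpoints, and then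
by decreasing left endpoints. -/
def IsRightSorted {n : ℕ} {V : Type} (ℓ r : V → ℕ) (σ : Fin n → V) : Prop :=
  ∀ i j, i < j → r (σ i) ≤ r (σ j) ∧ (r (σ i) = r (σ j) → ℓ (σ j) ≤ ℓ (σ i))

theorem IsRightSorted.monotone {n : ℕ} {V : Type} {ℓ r : V → ℕ} {σ : Fin n → V}
    (h : IsRightSorted ℓ r σ) :
    Monotone ((fun v => toLex (r v, OrderDual.toDual (ℓ v))) ∘ σ) := by
  intro i j hij
  rcases hij.eq_or_lt with rfl | hij
  · exact le_rfl
  · rw [Function.comp_apply, Function.comp_apply, Prod.Lex.toLex_le_toLex]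
    obtain ⟨h1, h2⟩ := h i j hij
    rcases h1.lt_or_eq with h1 | h1
    · exact .inl h1
    · exact .inr ⟨h1, OrderDual.toDual_le_toDual.2 (h2 h1)⟩

namespace IsLaminarFamily

variable {n : ℕ} {ℓ r : Fin n → ℕ} {σ : Equiv.Perm (Fin n)}

theorem isRGF (h : IsLaminarFamily ℓ r) (hσ : IsRightSorted ℓ r σ) : IsRGF (ℓ ∘ σ) := by
  intro i v hv
  rw [Function.comp_apply] at hv
  have hle := h.le (σ i)
  obtain ⟨k, hkl, hkr⟩ := h.exists_point (σ i) v (by omega)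
  obtain ⟨j, rfl⟩ := σ.surjective k
  refine ⟨j, ?_, hkl⟩
  by_contra! hij
  rcases hij.eq_or_lt with rfl | hij
  · omega
  · have := hσ i j hij
    omega

/-- In a 101 at `p, q, s`, the intervals of `q` and `s` would cross. -/
theorem avoids101 (h : IsLaminarFamily ℓ r) (hσ : IsRightSorted ℓ r σ) : Avoids101 (ℓ ∘ σ) := by
  intro p q s hpq hqs hps hlt
  simp only [Function.comp_apply] at hps hlt
  have h1 := hσ p q hpq
  have h2 := hσ q s hqs
  have h3 := h.le (σ p)
  have h4 := h.noncrossing (σ q) (σ s)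
  omega

/-- Among the intervals with right endpoint `ρ`, a point `[ρ, ρ]` is listed first. -/
theorem prefixMax_eq (h : IsLaminarFamily ℓ r) (hσ : IsRightSorted ℓ r σ) :
    prefixMax (ℓ ∘ σ) = r ∘ σ := by
  funext i
  refine le_antisymm (Finset.sup_le fun j hj => ?_) ?_
  · rcases (Finset.mem_Iic.1 hj).eq_or_lt with rfl | hj
    · exact h.le _
    · exact (h.le _).trans (hσ j i hj).1
  · obtain ⟨k, hkl, hkr⟩ := h.exists_point (σ i) _ le_rfl
    obtain ⟨j, rfl⟩ := σ.surjective k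
    rcases le_or_gt j i with hji | hij
    · exact hkl.ge.trans (le_prefixMax (ℓ ∘ σ) hji)
    · have h1 := hσ i j hij
      have h2 := le_prefixMax (ℓ ∘ σ) (le_refl i)
      simp only [Function.comp_apply] at h2 ⊢
      omega

/-- The family is the lexicographic rearrangement of its sequence of left endpoints and the
prefix maxima of this sequence. -/
theorem eq_of_comp_eq {ℓ' r' : Fin n → ℕ} {σ' : Equiv.Perm (Fin n)} (h : IsLaminarFamily ℓ r)
    (hσ : IsRightSorted ℓ r σ) (h' : IsLaminarFamily ℓ' r') (hσ' : IsRightSorted ℓ' r' σ')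
    (heq : ℓ ∘ σ = ℓ' ∘ σ') : ℓ = ℓ' ∧ r = r' := by
  have hmono : ∀ {ℓ r : Fin n → ℕ}, IsLaminarFamily ℓ r →
      Monotone fun i => toLex (ℓ i, r i) := by
    intro ℓ r h i j hij
    rcases hij.eq_or_lt with rfl | hij
    · exact le_rfl
    · rw [Prod.Lex.toLex_le_toLex]
      obtain ⟨h1, h2⟩ := h.lex i j hij
      rcases h1.lt_or_eq with h1 | h1
      · exact .inl h1
      · exact .inr ⟨h1, h2 h1⟩
  have hr : r ∘ σ = r' ∘ σ' := by
    rw [← h.prefixMax_eq hσ, ← h'.prefixMax_eq hσ', heq]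
  have key : ((fun i => toLex (ℓ i, r i)) ∘ σ) = (fun i => toLex (ℓ' i, r' i)) ∘ σ' := by
    funext i
    have h1 := congrFun heq i
    have h2 := congrFun hr i
    simp only [Function.comp_apply] at h1 h2 ⊢
    rw [h1, h2]
  have h1 : ((fun i => toLex (ℓ i, r i)) ∘ σ) ∘ (σ.symm : Equiv.Perm (Fin n)) =
      fun i => toLex (ℓ i, r i) := by
    funext i
    simp
  have h2 : ((fun i => toLex (ℓ i, r i)) ∘ σ) ∘ (σ'.symm : Equiv.Perm (Fin n)) =
      fun i => toLex (ℓ' i, r' i) := by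
    rw [key]
    funext i
    simp
  have hfun := Tuple.unique_monotone (f := (fun i => toLex (ℓ i, r i)) ∘ σ) (σ := σ.symm)
    (τ := σ'.symm) (by rw [h1]; exact hmono h) (by rw [h2]; exact hmono h')
  rw [h1, h2] at hfun
  constructor
  · funext i
    exact congrArg (fun p => (ofLex p).1) (congrFun hfun i)
  · funext i
    exact congrArg (fun p => (ofLex p).2) (congrFun hfun i)

end IsLaminarFamily

theorem IsRGF.isRightSorted {n : ℕ} {α : Fin n → ℕ} (hα : IsRGF α) (h : Avoids101 α) :
    IsRightSorted α (prefixMax α) id := by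
  intro i j hij
  refine ⟨prefixMax_monotone α hij.le, fun heq => ?_⟩
  by_contra! hlt
  simp only [id] at heq hlt
  obtain ⟨k, hk, hkv⟩ := hα.exists_of_le_prefixMax (i := i) (v := α j)
    (by rw [heq]; exact le_prefixMax α le_rfl)
  rcases hk.eq_or_lt with rfl | hk
  · omega
  · exact h k i j hk hij hkv (by omega)

theorem IsRGF.isLaminarFamily {n : ℕ} {α : Fin n → ℕ} (hα : IsRGF α) (h : Avoids101 α) :
    ∃ τ : Equiv.Perm (Fin n), IsLaminarFamily (α ∘ τ) (prefixMax α ∘ τ) := by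
  have hpoint : ∀ i, ∀ j ≤ prefixMax α i, ∃ k, α k = j ∧ prefixMax α k = j := by
    intro i j
    induction i using WellFoundedLT.induction with
    | _ i ih =>
      intro hj
      obtain ⟨k, hk, hkj⟩ := hα.exists_of_le_prefixMax hj
      -- If a larger entry precedes `k`, restricted growth puts `j` before that entry; descending,
      -- one reaches an occurrence of `j` as a prefix maximum.
      by_cases hmax : prefixMax α k = j
      · exact ⟨k, hkj, hmax⟩
      · obtain ⟨m, hm, hmv⟩ := exists_eq_prefixMax α k
        have hle := le_prefixMax α (le_refl k)
        obtain ⟨s, hs, hsv⟩ := hα m j (by omega)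
        exact ih s (hs.trans_le (hm.trans hk)) (hsv ▸ le_prefixMax α le_rfl)
  let f : Fin n → ℕ ×ₗ ℕ := fun i => toLex (α i, prefixMax α i)
  refine ⟨Tuple.sort f, fun i => le_prefixMax α le_rfl, ?_, ?_, ?_⟩
  · intro i j hij
    have hle := Prod.Lex.le_iff.1 (Tuple.monotone_sort f hij.le)
    change α _ < α _ ∨ α _ = α _ ∧ prefixMax α _ ≤ prefixMax α _ at hle
    simp only [Function.comp_apply]
    omega
  · intro i j hj
    obtain ⟨k, hk⟩ := hpoint _ j hj
    exact ⟨(Tuple.sort f).symm k, by simpa using hk⟩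
  · intro i j h1 h2 h3
    simp only [Function.comp_apply] at h1 h2 h3
    have hij : Tuple.sort f i < Tuple.sort f j := (prefixMax_monotone α).reflect_lt h3
    -- For crossing intervals the larger left endpoint has occurred before the smaller one, which
    -- gives a 101.
    obtain ⟨k, hk, hkv⟩ := hα.exists_of_le_prefixMax h2
    rcases hk.eq_or_lt with rfl | hk
    · omega
    · exact h k _ _ hk hij hkv (by omega)

/-! ### The main theorem -/

namespace Matching

variable {n : ℕ}

theorem Represents.exists_Psi_eq {M : Matching n} {ℓ r : Fin n → ℕ} (h : M.Represents ℓ r)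
    (hf : IsLaminarFamily ℓ r) :
    ∃ σ : Equiv.Perm (Fin n), M.Psi = ℓ ∘ σ ∧ IsRightSorted ℓ r σ := by
  obtain ⟨σ, hinj, -, hseq, hsort⟩ :=
    FinPoset.IsPointed.exists_toSeq_eq n M.toPoset (h.isPointed hf) (Finset.card_fin n)
  exact ⟨Equiv.ofBijective σ (Finite.injective_iff_bijective.1 hinj), funext hseq, hsort⟩

theorem Psi_bijOn (n : ℕ) :
    Set.BijOn (Psi (n := n)) {M | M.IsStoimenow ∧ ¬ M.Contains patternP2}
      {α | IsRGF α ∧ Avoids101 α} := by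
  refine ⟨?_, ?_, ?_⟩
  · rintro M ⟨hM, hP⟩
    obtain ⟨ℓ, r, h, hf⟩ := hM.exists_represents hP
    obtain ⟨σ, hΨ, hσ⟩ := h.exists_Psi_eq hf
    rw [hΨ]
    exact ⟨hf.isRGF hσ, hf.avoids101 hσ⟩
  · rintro M ⟨hM, hP⟩ M' ⟨hM', hP'⟩ heq
    obtain ⟨ℓ, r, h, hf⟩ := hM.exists_represents hP
    obtain ⟨σ, hΨ, hσ⟩ := h.exists_Psi_eq hf
    obtain ⟨ℓ', r', h', hf'⟩ := hM'.exists_represents hP'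
    obtain ⟨σ', hΨ', hσ'⟩ := h'.exists_Psi_eq hf'
    rw [hΨ, hΨ'] at heq
    obtain ⟨rfl, rfl⟩ := hf.eq_of_comp_eq hσ hf' hσ' heq
    exact h.unique h'
  · rintro α ⟨hα, h101⟩
    obtain ⟨τ, hf⟩ := hα.isLaminarFamily h101
    obtain ⟨M, h⟩ := exists_represents hf.le fun i j hij => (hf.lex i j hij).1
    obtain ⟨σ, hΨ, hσ⟩ := h.exists_Psi_eq hf
    refine ⟨M, ⟨h.isStoimenow hf, h.not_contains_patternP2 hf.noncrossing⟩, ?_⟩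
    -- Both Ψ(M) and `α` arrange the same pairs of endpoints in sorted order, so they coincide.
    have h1 : Monotone ((fun i => toLex (prefixMax α i, OrderDual.toDual (α i))) ∘
        (σ.trans τ : Equiv.Perm (Fin n))) := hσ.monotone
    have h2 := (hα.isRightSorted h101).monotone
    have key := Tuple.unique_monotone (τ := Equiv.refl (Fin n)) h1 h2
    rw [hΨ]
    funext i
    exact congrArg (fun p => OrderDual.ofDual (ofLex p).2) (congrFun key i)

end Matching

end Fishburn

theorem mainTheorem10 (n : ℕ) :
    Set.BijOn (Fishburn.Upsilon (n := n))
      {M : Fishburn.Matching n | M.IsStoimenow ∧ ¬ M.Contains Fishburn.Matching.patternP2}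
      {π : Equiv.Perm (Fin n) |
        Fishburn.IsFishburn π ∧ ¬ Fishburn.ContainsPattern π ![3, 1, 4, 2]} ∧
    (∀ α : Fin n → ℕ, Fishburn.IsAscentSeq α →
      (¬ Fishburn.ContainsPattern α ![0, 1, 0, 1] ↔ ¬ Fishburn.ContainsPattern α ![1, 0, 1])) ∧
    (∀ α : Fin n → ℕ, Fishburn.IsAscentSeq α → ¬ Fishburn.ContainsPattern α ![0, 1, 0, 1] →
      Fishburn.Delta α = α) := by
  refine ⟨?_, fun α hα => ?_, fun α hα h => ?_⟩
  · refine ((Fishburn.transposition_bijOn n).comp (Fishburn.Matching.Psi_bijOn n)).congr ?_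
    intro M hM
    obtain ⟨hα, h⟩ := (Fishburn.Matching.Psi_bijOn n).mapsTo hM
    rw [Fishburn.Upsilon, Fishburn.Delta_eq_self hα h, Function.comp_apply]
  · rw [Fishburn.not_containsPattern_101_iff]
    exact ⟨fun h => (hα.isRGF h).avoids101 h, fun h => h.not_containsPattern_0101⟩
  · have hrgf := hα.isRGF h
    exact Fishburn.Delta_eq_self hrgf (hrgf.avoids101 h)
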